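/- **Setting.** Let $(\Omega,\mathcal F,\mathbb P)$ be a complete probability space carrying a standard $n$-dimensional Brownian motion $W=(W_s)_{s\ge0}$. For $r\ge 0$ let $\mathbb F_r=(\mathcal F_{r,s})_{s\ge 0}$, where $\mathcal F_{r,s}$ is the $\mathbb P$-completion of $\sigma(W_q-W_r:\ r\le q\le r\vee s)$; thus $\mathbb F:=\mathbb F_0$ is the completed Brownian filtration. Let $\mathbb U\subset\mathbb R^m$ be compact and let $f:\mathbb R^n\times\mathbb U\to\mathbb R^n$ and $\sigma:\mathbb R^n\times\mathbb U\to\mathbb R^{n\times n}$ be continuous, and Lipschitz in the first argument uniformly in the second. Let $\mathcal U_r$ be the set of $\mathbb F_r$-progressively measurable processes with values in $\mathbb U$. For $t\ge r$, $x\in\mathbb R^n$ and $u\in\mathcal U_r$ let $X=X^{t,x}_{u}$ be the strong solution ($\mathbb F_r$-adapted, with continuous paths) of $$dX_s=f(X_s,u_s)\,ds+\sigma(X_s,u_s)\,dW_s,\quad s\ge t,\qquad X_s=x\ \text{ for } s\le t .$$ Let $A,B\subset\mathbb R^n$ be disjoint, $A$ Borel and $B$ closed, and let $0\le r\le t\le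 T$. (For $r=0$ the policies are all $\mathbb F$-progressively measurable ones and the stopping times below are all $\mathbb F$-stopping times with values in $[t,T]$; for $r=t$ both depend only on the increments of $W$ after time $t$.) Put $\tau_B=\inf\{s\ge t:\ X_s\in B\}$ ($\inf\emptyset=\infty$) and let $\mathcal T_{[t,T]}$ be the set of $\mathbb F_r$-stopping times $\theta$ with $t\le\theta\le T$ almost surely. Define $$\widetilde{\mathrm{RA}}(t,p;A,B)=\Big\{x\in\mathbb R^n:\ \exists\,u\in\mathcal U_r,\ \ \mathbb P\big(X^{t,x}_{u}(T)\in A\ \text{and}\ X^{t,x}_{u}(q)\notin B\ \ \forall q\in[t,T]\big)>p\Big\}$$ and, with $X=X^{t,x}_u$, $$\widetilde V_1(t,x)=\sup_{u\in\mathcal U_r}\mathbb E\big[1_A(X_{\tau_B\wedge T})\big],\qquad \widetilde V_2(t,x)=\sup_{u\in\mathcal U_r}\mathbb E\Big[1_A(X_T)\wedge\inf_{q\in[t,T]}1_{B^c}(X_q)\Big],$$ $$\widetilde V_3(t,x)=\sup_{u\in\mathcal U_r}\ \inf_{\theta\in\mathcal T_{[t,T]}}\mathbb E\big[1_A(X_T)\wedge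 1_{B^c}(X_\theta)\big].$$ **Proposition.** For every $p\in[0,1]$, $$\widetilde{\mathrm{RA}}(t,p;A,B)=\{x\in\mathbb R^n:\ \widetilde V_1(t,x)>p\},$$ and $\widetilde V_1(t,x)=\widetilde V_2(t,x)=\widetilde V_3(t,x)$ for all $x\in\mathbb R^n$. -/

import Mathlib

open MeasureTheory ProbabilityTheory Filter
open scoped NNReal ENNReal Topology

noncomputable section

namespace ReachAvoid

/-- The Euclidean space `ℝⁿ`. -/
abbrev Euc (n : ℕ) : Type := EuclideanSpace ℝ (Fin n)

/-! ### The driving Brownian motion and its filtrations -/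

/-- `W` is a standard `n`-dimensional Brownian motion: its coordinates are independent standard
one-dimensional Brownian motions. -/
structure IsBrownianMotion {Ω : Type*} [MeasurableSpace Ω] {n : ℕ}
    (W : ℝ≥0 → Ω → Euc n) (μ : Measure Ω) : Prop where
  measurable : ∀ s, Measurable (W s)
  coord : ∀ i, IsBrownianReal (fun s ω => W s ω i) μ
  indep : iIndepFun (fun (i : Fin n) (ω : Ω) (s : ℝ≥0) => W s ω i) μ

/-- The σ-algebra generated by the increments `W q - W r`, `r ≤ q ≤ max r s`. -/
@[reducible] def incrementSigma {Ω : Type*} {n : ℕ} (W : ℝ≥0 → Ω → Euc n) (r s : ℝ≥0) :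
    MeasurableSpace Ω :=
  ⨆ q ∈ Set.Icc r (max r s),
    MeasurableSpace.comap (fun ω => W q ω - W r ω) inferInstance

/-- The filtration `𝔽_r = (𝓕_{r,s})_{s ≥ 0}`, where `𝓕_{r,s}` is the `μ`-completion of
`σ(W_q - W_r, r ≤ q ≤ max r s)`, i.e. the σ-algebra of all sets which differ from a set of that
σ-algebra by a `μ`-null set. For `r = 0` this is the completed filtration of `W`. -/
def incrementFiltration {Ω : Type*} [mΩ : MeasurableSpace Ω] {n : ℕ} {W : ℝ≥0 → Ω → Euc n}
    {μ : Measure Ω} [μ.IsComplete] (hW : IsBrownianMotion W μ) (r : ℝ≥0) :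
    Filtration ℝ≥0 mΩ where
  seq s := @eventuallyMeasurableSpace Ω (incrementSigma W r s) (ae μ) _
  mono' := by
    intro s s' hss' A hA
    obtain ⟨C, hC, hAC⟩ := hA
    refine ⟨C, ?_, hAC⟩
    have hle : incrementSigma W r s ≤ incrementSigma W r s' :=
      biSup_mono fun q hq => ⟨hq.1, hq.2.trans (max_le_max le_rfl hss')⟩
    exact hle C hC
  le' := by
    intro s A hA
    obtain ⟨C, hC, hAC⟩ := hA
    have hle : incrementSigma W r s ≤ mΩ :=
      iSup₂_le fun q _ =>
        ((hW.measurable q).sub (hW.measurable r)).comap_le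
    have hC' : MeasurableSet[mΩ] C := hle C hC
    exact (NullMeasurableSet.congr hC'.nullMeasurableSet hAC.symm).measurable_of_complete

/-! ### The controlled system -/

/-- The data of the controlled equation `dX = f(X,u) ds + σ(X,u) dW`: the drift `f`, the diffusion
matrix `σ`, and the set of control values. -/
structure ControlledSDE (n m : ℕ) where
  drift : Euc n → Euc m → Euc n
  diffusion : Euc n → Euc m → Matrix (Fin n) (Fin n) ℝ
  controlSet : Set (Euc m)

/-- The control set is compact; drift and diffusion are (jointly) continuous, and Lipschitz in the
state uniformly with respect to the control value (for the matrix, this is stated entrywise). -/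
structure ControlledSDE.BasicAssumption {n m : ℕ} (S : ControlledSDE n m) : Prop where
  isCompact : IsCompact S.controlSet
  drift_continuous :
    ContinuousOn (fun z : Euc n × Euc m => S.drift z.1 z.2) (Set.univ ×ˢ S.controlSet)
  drift_lipschitz : ∃ L : ℝ, ∀ u ∈ S.controlSet, ∀ x y : Euc n,
    ‖S.drift x u - S.drift y u‖ ≤ L * ‖x - y‖
  diffusion_continuous :
    ContinuousOn (fun z : Euc n × Euc m => S.diffusion z.1 z.2) (Set.univ ×ˢ S.controlSet)
  diffusion_lipschitz : ∃ L : ℝ, ∀ u ∈ S.controlSet, ∀ x y : Euc n, ∀ i j,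
    |S.diffusion x u i j - S.diffusion y u i j| ≤ L * ‖x - y‖

/-- The `𝔽`-progressively measurable policies with values in the control set. -/
def ControlledSDE.policies {Ω : Type*} [mΩ : MeasurableSpace Ω] {n m : ℕ} (S : ControlledSDE n m)
    (𝔽 : Filtration ℝ≥0 mΩ) : Set (ℝ≥0 → Ω → Euc m) :=
  {u | IsProgressive 𝔽 u ∧ ∀ s ω, u s ω ∈ S.controlSet}

/-! ### The Itô integral -/

/-- A bounded simple integrand on `(t, ∞)`:
`∑_{k < N} coef k * 1_{(time k, time (k+1)]}` with `t ≤ time 0 ≤ time 1 ≤ ⋯` and `coef k` a bounded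
`𝓕_{time k}`-measurable random matrix. -/
structure SimpleIntegrand {Ω : Type*} [mΩ : MeasurableSpace Ω] (n : ℕ)
    (𝔽 : Filtration ℝ≥0 mΩ) (t : ℝ≥0) where
  N : ℕ
  time : ℕ → ℝ≥0
  time_mono : Monotone time
  le_time : t ≤ time 0
  coef : ℕ → Ω → Matrix (Fin n) (Fin n) ℝ
  coef_measurable : ∀ k i j, Measurable[𝔽 (time k)] fun ω => coef k ω i j
  coef_bounded : ∃ C : ℝ, ∀ k ω i j, |coef k ω i j| ≤ C

/-- The integrand as a process. -/
def SimpleIntegrand.process {Ω : Type*} [mΩ : MeasurableSpace Ω] {n : ℕ}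
    {𝔽 : Filtration ℝ≥0 mΩ} {t : ℝ≥0} (Φ : SimpleIntegrand n 𝔽 t) (s : ℝ≥0) (ω : Ω) :
    Matrix (Fin n) (Fin n) ℝ :=
  ∑ k ∈ Finset.range Φ.N,
    (Set.Ioc (Φ.time k) (Φ.time (k + 1))).indicator (fun _ => Φ.coef k ω) s

/-- The elementary integral `∫_t^s Φ dW` of a simple integrand. -/
def SimpleIntegrand.integral {Ω : Type*} [mΩ : MeasurableSpace Ω] {n : ℕ}
    {𝔽 : Filtration ℝ≥0 mΩ} {t : ℝ≥0} (Φ : SimpleIntegrand n 𝔽 t) (W : ℝ≥0 → Ω → Euc n)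
    (s : ℝ≥0) (ω : Ω) : Euc n :=
  ∑ k ∈ Finset.range Φ.N,
    Matrix.toEuclideanCLM (𝕜 := ℝ) (Φ.coef k ω)
      (W (min s (Φ.time (k + 1))) ω - W (min s (Φ.time k)) ω)

/-- `I` is the Itô integral `I_s = ∫_t^s H dW`, `s ≥ t`, of the matrix process `H`: there are simple
integrands `Φ k` such that, for every `s ≥ t`, `∫_t^s |Φ k - H|² dq → 0` in probability and
`∫_t^s Φ k dW → I_s` in probability. -/
def IsItoIntegral {Ω : Type*} [mΩ : MeasurableSpace Ω] {n : ℕ} (μ : Measure Ω)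
    (𝔽 : Filtration ℝ≥0 mΩ) (W : ℝ≥0 → Ω → Euc n) (t : ℝ≥0)
    (H : ℝ≥0 → Ω → Matrix (Fin n) (Fin n) ℝ) (I : ℝ≥0 → Ω → Euc n) : Prop :=
  ∃ Φ : ℕ → SimpleIntegrand n 𝔽 t, ∀ s, t ≤ s →
    (∀ ε : ℝ≥0∞, 0 < ε → Tendsto (fun k => μ {ω | ε ≤ ∫⁻ q in Set.Ioc (t : ℝ) (s : ℝ),
        ∑ i, ∑ j, ‖(Φ k).process q.toNNReal ω i j - H q.toNNReal ω i j‖ₑ ^ 2})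
      atTop (𝓝 0)) ∧
    TendstoInMeasure μ (fun k => (Φ k).integral W s) atTop (I s)

/-! ### The controlled process -/

/-- `X` is a strong solution of the controlled equation started at time `t` from `x`, under the
policy `u`, extended by `X_s = x` for `s ≤ t`. -/
structure IsStrongSolution {Ω : Type*} [mΩ : MeasurableSpace Ω] {n m : ℕ} (S : ControlledSDE n m)
    (μ : Measure Ω) (𝔽 : Filtration ℝ≥0 mΩ) (W : ℝ≥0 → Ω → Euc n) (t : ℝ≥0) (x : Euc n)
    (u : ℝ≥0 → Ω → Euc m) (X : ℝ≥0 → Ω → Euc n) : Prop where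
  adapted : ∀ s, Measurable[𝔽 s] (X s)
  continuous : ∀ ω, Continuous fun s => X s ω
  initial : ∀ s, s ≤ t → ∀ ω, X s ω = x
  equation : ∃ I : ℝ≥0 → Ω → Euc n,
    IsItoIntegral μ 𝔽 W t (fun s ω => S.diffusion (X s ω) (u s ω)) I ∧
    ∀ᵐ ω ∂μ, ∀ s, t ≤ s → X s ω =
      x + (∫ q in (t : ℝ)..(s : ℝ), S.drift (X q.toNNReal ω) (u q.toNNReal ω)) + I s ω

open Classical in
/-- The controlled process `X^{t,x}_u`: the strong solution (unique up to indistinguishability)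
started at time `t` from `x` under the policy `u`. The default value in the second case is never
used for an admissible policy of a system satisfying the basic assumption. -/
def state {Ω : Type*} [mΩ : MeasurableSpace Ω] {n m : ℕ} (S : ControlledSDE n m)
    (μ : Measure Ω) (𝔽 : Filtration ℝ≥0 mΩ) (W : ℝ≥0 → Ω → Euc n) (t : ℝ≥0) (x : Euc n)
    (u : ℝ≥0 → Ω → Euc m) : ℝ≥0 → Ω → Euc n :=
  if h : ∃ X, IsStrongSolution S μ 𝔽 W t x u X then h.choose else fun _ _ => x

/-- The indicator function of a set of states. -/
def ind {n : ℕ} (A : Set (Euc n)) : Euc n → ℝ := A.indicator fun _ => 1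

/-- The first entry time `τ_B = inf {s ≥ t | X_s ∈ B}` (`⊤` if there is no such `s`). -/
def entryTime {Ω : Type*} {n : ℕ} (X : ℝ≥0 → Ω → Euc n) (t : ℝ≥0) (B : Set (Euc n)) :
    Ω → WithTop ℝ≥0 :=
  hittingAfter X B t

/-- The `𝔽`-stopping times `τ` with `a ≤ τ ≤ b` almost surely. -/
def stoppingTimes {Ω : Type*} [mΩ : MeasurableSpace Ω] (μ : Measure Ω) (𝔽 : Filtration ℝ≥0 mΩ)
    (a b : ℝ≥0) : Set (Ω → WithTop ℝ≥0) :=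
  {τ | IsStoppingTime 𝔽 τ ∧ ∀ᵐ ω ∂μ, (a : WithTop ℝ≥0) ≤ τ ω ∧ τ ω ≤ (b : WithTop ℝ≥0)}

/-! ### The reach-avoid set at the terminal time and the three value functions -/

/-- The states from which some policy brings the process into `A` at time `T`, while avoiding `B`
during `[t,T]`, with probability larger than `p`. -/
def terminalReachAvoid {Ω : Type*} [mΩ : MeasurableSpace Ω] {n m : ℕ} (S : ControlledSDE n m)
    (μ : Measure Ω) (𝔽 : Filtration ℝ≥0 mΩ) (W : ℝ≥0 → Ω → Euc n) (T : ℝ≥0)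
    (A B : Set (Euc n)) (t : ℝ≥0) (p : ℝ) : Set (Euc n) :=
  {x | ∃ u ∈ S.policies 𝔽,
    p < μ.real {ω | state S μ 𝔽 W t x u T ω ∈ A ∧
      ∀ r ∈ Set.Icc t T, state S μ 𝔽 W t x u r ω ∉ B}}

/-- `sup_u E[1_A(X_{τ_B ∧ T})]`. -/
def value₁ {Ω : Type*} [mΩ : MeasurableSpace Ω] {n m : ℕ} (S : ControlledSDE n m)
    (μ : Measure Ω) (𝔽 : Filtration ℝ≥0 mΩ) (W : ℝ≥0 → Ω → Euc n) (T : ℝ≥0)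
    (A B : Set (Euc n)) (t : ℝ≥0) (x : Euc n) : ℝ :=
  ⨆ u : S.policies 𝔽,
    ∫ ω, ind A (stoppedValue (state S μ 𝔽 W t x u)
      (fun ω' => min (entryTime (state S μ 𝔽 W t x u) t B ω') (T : WithTop ℝ≥0)) ω) ∂μ

/-- `sup_u E[1_A(X_T) ∧ inf_{r ∈ [t,T]} 1_{Bᶜ}(X_r)]`. -/
def value₂ {Ω : Type*} [mΩ : MeasurableSpace Ω] {n m : ℕ} (S : ControlledSDE n m)
    (μ : Measure Ω) (𝔽 : Filtration ℝ≥0 mΩ) (W : ℝ≥0 → Ω → Euc n) (T : ℝ≥0)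
    (A B : Set (Euc n)) (t : ℝ≥0) (x : Euc n) : ℝ :=
  ⨆ u : S.policies 𝔽,
    ∫ ω, min (ind A (state S μ 𝔽 W t x u T ω))
      (⨅ r : Set.Icc t T, ind Bᶜ (state S μ 𝔽 W t x u r ω)) ∂μ

/-- `sup_u inf_σ E[1_A(X_T) ∧ 1_{Bᶜ}(X_σ)]`, where `σ` ranges over the stopping times with values
in `[t,T]`. -/
def value₃ {Ω : Type*} [mΩ : MeasurableSpace Ω] {n m : ℕ} (S : ControlledSDE n m)
    (μ : Measure Ω) (𝔽 : Filtration ℝ≥0 mΩ) (W : ℝ≥0 → Ω → Euc n) (T : ℝ≥0)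
    (A B : Set (Euc n)) (t : ℝ≥0) (x : Euc n) : ℝ :=
  ⨆ u : S.policies 𝔽, ⨅ σ : stoppingTimes μ 𝔽 t T,
    ∫ ω, min (ind A (state S μ 𝔽 W t x u T ω))
      (ind Bᶜ (stoppedValue (state S μ 𝔽 W t x u) σ ω)) ∂μ

end ReachAvoid

end

open MeasureTheory ProbabilityTheory Filter
open scoped NNReal ENNReal Topology

/-! Fix a policy and let `X` be the resulting state, a continuous adapted process. All three payoffs
reduce to the probability of one event, `reachAvoidEvent`. Since `B` is closed and paths are
continuous, a path that meets `B` during `[t,T]` lies in `B`, hence outside `A`, at time `τ_B ∧ T`;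
any other path has `τ_B ∧ T = T`. So the first two payoffs are pathwise the indicator of the event.
In the third, every admissible stopping time gives at least that indicator almost surely, and `τ_B ∧
T` gives exactly it (`iInf_integral_min_ind_stoppedValue`). Taking the supremum over policies gives
the equalities, and a supremum exceeds `p` exactly when some policy does. -/

namespace ReachAvoid

/-! ### Hitting times of closed sets by continuous processes -/

section HittingTimes

variable {Ω E : Type*} [PseudoEMetricSpace E] {X : ℝ≥0 → Ω → E} {t : ℝ≥0} {B : Set E}

/-- A continuous process which visits a closed set after time `t` is in that set at the hitting
time. -/
theorem exists_hittingAfter_eq_of_mem (hB : IsClosed B) {ω : Ω}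
    (hc : Continuous fun q => X q ω) {q : ℝ≥0} (htq : t ≤ q) (hq : X q ω ∈ B) :
    ∃ q₀ : ℝ≥0, hittingAfter X B t ω = (q₀ : WithTop ℝ≥0) ∧ t ≤ q₀ ∧ q₀ ≤ q ∧ X q₀ ω ∈ B := by
  have hclosed : IsClosed {i : ℝ≥0 | t ≤ i ∧ X i ω ∈ B} :=
    isClosed_Ici.inter (hB.preimage hc)
  -- The visiting times form a nonempty closed set, so their infimum is itself a visiting time.
  have hmem := hclosed.csInf_mem ⟨q, htq, hq⟩ (OrderBot.bddBelow _)
  refine ⟨sInf {i : ℝ≥0 | t ≤ i ∧ X i ω ∈ B}, ?_, hmem.1,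
    csInf_le (OrderBot.bddBelow _) ⟨htq, hq⟩, hmem.2⟩
  rw [hittingAfter_def]
  exact if_pos ⟨q, htq, hq⟩

theorem hittingAfter_le_coe_iff (hB : IsClosed B) {ω : Ω} (hc : Continuous fun q => X q ω)
    {s : ℝ≥0} :
    hittingAfter X B t ω ≤ (s : WithTop ℝ≥0) ↔ ∃ q ∈ Set.Icc t s, X q ω ∈ B := by
  constructor
  · intro h
    have hne : hittingAfter X B t ω ≠ ⊤ := (h.trans_lt (WithTop.coe_lt_top s)).ne
    rw [Ne, hittingAfter_eq_top_iff] at hne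
    push Not at hne
    obtain ⟨q, htq, hq⟩ := hne
    obtain ⟨q₀, h₀, ht₀, -, hB₀⟩ := exists_hittingAfter_eq_of_mem hB hc htq hq
    rw [h₀, WithTop.coe_le_coe] at h
    exact ⟨q₀, ⟨ht₀, h⟩, hB₀⟩
  · rintro ⟨q, ⟨htq, hqs⟩, hq⟩
    exact (hittingAfter_le_of_mem htq hq).trans (WithTop.coe_le_coe.2 hqs)

variable {mΩ : MeasurableSpace Ω} [MeasurableSpace E] [BorelSpace E]

/-- The event that a continuous process visits a closed set during a compact time interval is
measurable with respect to the information available at the end of the interval. -/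
theorem measurableSet_exists_mem_Icc {m : MeasurableSpace Ω} {s : ℝ≥0}
    (hB : IsClosed B) (hX : ∀ q ≤ s, Measurable[m] (X q)) (hc : ∀ ω, Continuous fun q => X q ω) :
    MeasurableSet[m] {ω | ∃ q ∈ Set.Icc t s, X q ω ∈ B} := by
  rcases lt_or_ge s t with hst | hts
  · simp [Set.Icc_eq_empty_of_lt hst]
  have : Nonempty (Set.Icc t s) := ⟨⟨t, le_rfl, hts⟩⟩
  have hcont (ω : Ω) : Continuous fun q : Set.Icc t s => Metric.infEDist (X q ω) B :=
    Metric.continuous_infEDist.comp ((hc ω).comp continuous_subtype_val)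
  -- The distance to `B` along a path is continuous, so its infimum over a countable dense set of
  -- times is its minimum over the compact interval. As `B` is closed, this minimum vanishes exactly
  -- when the path meets `B`.
  have heq : {ω | ∃ q ∈ Set.Icc t s, X q ω ∈ B} =
      {ω | ⨅ k, Metric.infEDist (X (TopologicalSpace.denseSeq (Set.Icc t s) k) ω) B = 0} := by
    ext ω
    simp only [Set.mem_ofPred_eq]
    constructor
    · rintro ⟨q, hq, hqB⟩
      refine le_antisymm (le_of_forall_gt fun ε hε => ?_) zero_le
      have hopen : IsOpen {q : Set.Icc t s | Metric.infEDist (X q ω) B < ε} :=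
        isOpen_lt (hcont ω) continuous_const
      obtain ⟨k, hk⟩ := (TopologicalSpace.denseRange_denseSeq (Set.Icc t s)).exists_mem_open hopen
        ⟨⟨q, hq⟩, by simpa [Metric.infEDist_zero_of_mem hqB] using hε⟩
      exact (iInf_le _ k).trans_lt hk
    · intro h
      obtain ⟨q, -, hq⟩ := isCompact_univ.exists_isMinOn Set.univ_nonempty (hcont ω).continuousOn
      refine ⟨q, q.2, (Metric.mem_iff_infEDist_zero_of_closed hB).2 (le_antisymm ?_ zero_le)⟩
      rw [← h]
      exact le_iInf fun k => hq (Set.mem_univ _)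
  rw [heq]
  exact (Measurable.iInf fun k => measurable_infEDist.comp
    (hX _ (TopologicalSpace.denseSeq (Set.Icc t s) k).2.2)) (measurableSet_singleton 0)

/-- The hitting time of a closed set by a continuous adapted process is a stopping time. -/
theorem isStoppingTime_hittingAfter_of_isClosed {𝔽 : Filtration ℝ≥0 mΩ} (hB : IsClosed B)
    (hX : ∀ s, Measurable[𝔽 s] (X s)) (hc : ∀ ω, Continuous fun q => X q ω) :
    IsStoppingTime 𝔽 (hittingAfter X B t) := by
  intro s
  have heq : {ω | hittingAfter X B t ω ≤ (s : WithTop ℝ≥0)} =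
      {ω | ∃ q ∈ Set.Icc t s, X q ω ∈ B} :=
    Set.ext fun ω => hittingAfter_le_coe_iff hB (hc ω)
  rw [heq]
  exact measurableSet_exists_mem_Icc hB (fun q hq => (hX q).mono (𝔽.mono hq) le_rfl) hc

end HittingTimes

/-! ### Payoffs for a fixed continuous adapted process -/

section Reach

theorem untopA_coe (q : ℝ≥0) : (q : WithTop ℝ≥0).untopA = q := rfl

variable {Ω : Type*} {n : ℕ} {X : ℝ≥0 → Ω → Euc n} {T t : ℝ≥0}
  {A B : Set (Euc n)}

/-- The event that the process is in `A` at time `T` and avoids `B` during `[t,T]`. -/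
def reachAvoidEvent (X : ℝ≥0 → Ω → Euc n) (T t : ℝ≥0) (A B : Set (Euc n)) : Set Ω :=
  {ω | X T ω ∈ A ∧ ∀ q ∈ Set.Icc t T, X q ω ∉ B}

theorem ind_of_mem {A : Set (Euc n)} {x : Euc n} (h : x ∈ A) : ind A x = 1 :=
  Set.indicator_of_mem h _

theorem ind_of_notMem {A : Set (Euc n)} {x : Euc n} (h : x ∉ A) : ind A x = 0 :=
  Set.indicator_of_notMem h _

theorem ind_nonneg (A : Set (Euc n)) (x : Euc n) : 0 ≤ ind A x :=
  Set.indicator_nonneg (fun _ _ => zero_le_one) x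

theorem ind_le_one (A : Set (Euc n)) (x : Euc n) : ind A x ≤ 1 :=
  Set.indicator_le_self' (fun _ _ => zero_le_one) x

theorem measurable_ind {A : Set (Euc n)} (hA : MeasurableSet A) : Measurable (ind A) :=
  measurable_const.indicator hA

theorem ind_stoppedValue_entryTime (hB : IsClosed B) (hAB : Disjoint A B)
    (hc : ∀ ω, Continuous fun s => X s ω) (ω : Ω) :
    ind A (stoppedValue X (fun ω' => min (entryTime X t B ω') (T : WithTop ℝ≥0)) ω) =
      (reachAvoidEvent X T t A B).indicator 1 ω := by
  by_cases h : ∃ q ∈ Set.Icc t T, X q ω ∈ B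
  · obtain ⟨q, ⟨htq, hqT⟩, hq⟩ := h
    obtain ⟨q₀, h₀, ht₀, hq₀, hB₀⟩ := exists_hittingAfter_eq_of_mem hB (hc ω) htq hq
    have hmin : min (entryTime X t B ω) (T : WithTop ℝ≥0) = (q₀ : WithTop ℝ≥0) := by
      rw [entryTime, h₀]
      exact min_eq_left (WithTop.coe_le_coe.2 (hq₀.trans hqT))
    rw [stoppedValue, hmin, untopA_coe, ind_of_notMem (hAB.notMem_of_mem_right hB₀),
      Set.indicator_of_notMem]
    exact fun hω => hω.2 q ⟨htq, hqT⟩ hq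
  · have hmin : min (entryTime X t B ω) (T : WithTop ℝ≥0) = (T : WithTop ℝ≥0) :=
      min_eq_right (not_le.1 (mt (hittingAfter_le_coe_iff hB (hc ω)).1 h)).le
    rw [stoppedValue, hmin, untopA_coe]
    push Not at h
    by_cases hXA : X T ω ∈ A
    · rw [ind_of_mem hXA, Set.indicator_of_mem (show ω ∈ reachAvoidEvent X T t A B from ⟨hXA, h⟩)]
      rfl
    · rw [ind_of_notMem hXA, Set.indicator_of_notMem fun hω => hXA hω.1]

theorem min_ind_iInf_ind (htT : t ≤ T) (ω : Ω) :
    min (ind A (X T ω)) (⨅ q : Set.Icc t T, ind Bᶜ (X q ω)) =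
      (reachAvoidEvent X T t A B).indicator 1 ω := by
  -- Over an empty index type the real infimum would take the default value `0`.
  have : Nonempty (Set.Icc t T) := ⟨⟨t, le_rfl, htT⟩⟩
  have hnonneg : 0 ≤ ⨅ q : Set.Icc t T, ind Bᶜ (X q ω) := le_ciInf fun q => ind_nonneg _ _
  by_cases hXA : X T ω ∈ A
  · rw [ind_of_mem hXA]
    by_cases h : ∃ q ∈ Set.Icc t T, X q ω ∈ B
    · obtain ⟨q, hqI, hq⟩ := h
      have hle : ⨅ q : Set.Icc t T, ind Bᶜ (X q ω) ≤ 0 :=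
        (ciInf_le ⟨0, Set.forall_mem_range.2 fun q => ind_nonneg _ _⟩ ⟨q, hqI⟩).trans
          (ind_of_notMem (not_not_intro hq)).le
      rw [le_antisymm hle hnonneg, Set.indicator_of_notMem fun hω => hω.2 q hqI hq]
      exact min_eq_right zero_le_one
    · push Not at h
      have heq : (fun q : Set.Icc t T => ind Bᶜ (X q ω)) = fun _ => 1 :=
        funext fun q => ind_of_mem (h q q.2)
      rw [heq, ciInf_const, min_self,
        Set.indicator_of_mem (show ω ∈ reachAvoidEvent X T t A B from ⟨hXA, h⟩)]
      rfl
  · rw [ind_of_notMem hXA, Set.indicator_of_notMem fun hω => hXA hω.1]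
    exact min_eq_left hnonneg

/-- `τ_B ∧ T` is the optimal adversarial time: it catches the path in `B` whenever this is possible.
Otherwise it equals `T`, itself a time of `[t,T]`, where the path is outside `B`. -/
theorem min_ind_stoppedValue_entryTime (hB : IsClosed B) (htT : t ≤ T)
    (hc : ∀ ω, Continuous fun s => X s ω) (ω : Ω) :
    min (ind A (X T ω))
        (ind Bᶜ (stoppedValue X (fun ω' => min (entryTime X t B ω') (T : WithTop ℝ≥0)) ω)) =
      (reachAvoidEvent X T t A B).indicator 1 ω := by
  by_cases h : ∃ q ∈ Set.Icc t T, X q ω ∈ B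
  · obtain ⟨q, ⟨htq, hqT⟩, hq⟩ := h
    obtain ⟨q₀, h₀, ht₀, hq₀, hB₀⟩ := exists_hittingAfter_eq_of_mem hB (hc ω) htq hq
    have hmin : min (entryTime X t B ω) (T : WithTop ℝ≥0) = (q₀ : WithTop ℝ≥0) := by
      rw [entryTime, h₀]
      exact min_eq_left (WithTop.coe_le_coe.2 (hq₀.trans hqT))
    rw [stoppedValue, hmin, untopA_coe, ind_of_notMem (A := Bᶜ) (not_not_intro hB₀),
      Set.indicator_of_notMem fun hω => hω.2 q ⟨htq, hqT⟩ hq]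
    exact min_eq_right (ind_nonneg _ _)
  · have hmin : min (entryTime X t B ω) (T : WithTop ℝ≥0) = (T : WithTop ℝ≥0) :=
      min_eq_right (not_le.1 (mt (hittingAfter_le_coe_iff hB (hc ω)).1 h)).le
    push Not at h
    have hT : ind Bᶜ (X T ω) = 1 := ind_of_mem (h T ⟨htT, le_rfl⟩)
    rw [stoppedValue, hmin, untopA_coe, hT]
    by_cases hXA : X T ω ∈ A
    · rw [ind_of_mem hXA, Set.indicator_of_mem (show ω ∈ reachAvoidEvent X T t A B from ⟨hXA, h⟩),
        min_self]
      rfl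
    · rw [ind_of_notMem hXA, Set.indicator_of_notMem fun hω => hXA hω.1]
      exact min_eq_left zero_le_one

/-- On the event the path is outside `B` at every time of `[t,T]`, whichever one `τ` selects. The
bounds are imposed at a single `ω` because stopping times satisfy them only almost surely. -/
theorem indicator_le_min_ind_stoppedValue {τ : Ω → WithTop ℝ≥0} {ω : Ω}
    (htτ : (t : WithTop ℝ≥0) ≤ τ ω) (hτT : τ ω ≤ (T : WithTop ℝ≥0)) :
    (reachAvoidEvent X T t A B).indicator 1 ω ≤
      min (ind A (X T ω)) (ind Bᶜ (stoppedValue X τ ω)) := by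
  by_cases hω : ω ∈ reachAvoidEvent X T t A B
  · lift τ ω to ℝ≥0 using (hτT.trans_lt (WithTop.coe_lt_top T)).ne with q hq
    have hqI : q ∈ Set.Icc t T := ⟨WithTop.coe_le_coe.1 htτ, WithTop.coe_le_coe.1 hτT⟩
    rw [Set.indicator_of_mem hω, ind_of_mem hω.1, stoppedValue, ← hq, untopA_coe,
      ind_of_mem (hω.2 q hqI), min_self]
    exact le_rfl
  · rw [Set.indicator_of_notMem hω]
    exact le_min (ind_nonneg _ _) (ind_nonneg _ _)

variable [mΩ : MeasurableSpace Ω] {μ : Measure Ω} {𝔽 : Filtration ℝ≥0 mΩ}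

theorem measurableSet_reachAvoidEvent (hA : MeasurableSet A) (hB : IsClosed B)
    (hX : ∀ s, Measurable (X s)) (hc : ∀ ω, Continuous fun s => X s ω) :
    MeasurableSet (reachAvoidEvent X T t A B) := by
  have h := (hX T hA).inter (measurableSet_exists_mem_Icc (t := t) (s := T) hB
    (fun q _ => hX q) hc).compl
  convert h using 1
  ext ω
  simp [reachAvoidEvent]

theorem const_mem_stoppingTimes (htT : t ≤ T) :
    (fun _ => (T : WithTop ℝ≥0)) ∈ stoppingTimes μ 𝔽 t T :=
  ⟨isStoppingTime_const 𝔽 T, ae_of_all _ fun _ => ⟨WithTop.coe_le_coe.2 htT, le_rfl⟩⟩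

theorem min_entryTime_mem_stoppingTimes (hB : IsClosed B) (htT : t ≤ T)
    (hX : ∀ s, Measurable[𝔽 s] (X s)) (hc : ∀ ω, Continuous fun s => X s ω) :
    (fun ω => min (entryTime X t B ω) (T : WithTop ℝ≥0)) ∈ stoppingTimes μ 𝔽 t T :=
  ⟨(isStoppingTime_hittingAfter_of_isClosed hB hX hc).min_const T,
    ae_of_all _ fun ω => ⟨le_min (le_hittingAfter ω) (WithTop.coe_le_coe.2 htT), min_le_right _ _⟩⟩

/-- The value at an almost surely bounded stopping time of a continuous adapted process is a
random variable. -/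
theorem aemeasurable_stoppedValue (hX : ∀ s, Measurable[𝔽 s] (X s))
    (hc : ∀ ω, Continuous fun s => X s ω) {τ : Ω → WithTop ℝ≥0}
    (hτ : τ ∈ stoppingTimes μ 𝔽 t T) : AEMeasurable (stoppedValue X τ) μ := by
  have hprog : IsStronglyProgressive 𝔽 X :=
    StronglyAdapted.isStronglyProgressive_of_continuous
      (fun s => (hX s).stronglyMeasurable) hc
  -- Truncation at `T` yields a bound valid everywhere and changes `τ` only on a null set.
  have hsm := stronglyMeasurable_stoppedValue_of_le hprog (hτ.1.min_const T)
    (fun ω => min_le_right (τ ω) (T : WithTop ℝ≥0))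
  refine ⟨_, (hsm.mono (𝔽.le T)).measurable, ?_⟩
  filter_upwards [hτ.2] with ω hω
  simp only [stoppedValue]
  rw [min_eq_left hω.2]

theorem integrable_min_ind_stoppedValue [IsFiniteMeasure μ] (hA : MeasurableSet A)
    (hB : IsClosed B) (hX : ∀ s, Measurable[𝔽 s] (X s)) (hc : ∀ ω, Continuous fun s => X s ω)
    {τ : Ω → WithTop ℝ≥0} (hτ : τ ∈ stoppingTimes μ 𝔽 t T) :
    Integrable (fun ω => min (ind A (X T ω)) (ind Bᶜ (stoppedValue X τ ω))) μ := by
  have hXT : Measurable (X T) := (hX T).mono (𝔽.le T) le_rfl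
  have hmeas : AEMeasurable (fun ω => min (ind A (X T ω)) (ind Bᶜ (stoppedValue X τ ω))) μ :=
    ((measurable_ind hA).comp hXT).aemeasurable.min
      ((measurable_ind hB.measurableSet.compl).comp_aemeasurable
        (aemeasurable_stoppedValue hX hc hτ))
  refine Integrable.of_bound hmeas.aestronglyMeasurable 1 (ae_of_all _ fun ω => ?_)
  rw [Real.norm_of_nonneg (le_min (ind_nonneg _ _) (ind_nonneg _ _))]
  exact (min_le_left _ _).trans (ind_le_one _ _)

theorem integral_ind_stoppedValue_entryTime (hA : MeasurableSet A) (hB : IsClosed B)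
    (hAB : Disjoint A B) (hX : ∀ s, Measurable[𝔽 s] (X s))
    (hc : ∀ ω, Continuous fun s => X s ω) :
    ∫ ω, ind A (stoppedValue X (fun ω' => min (entryTime X t B ω') (T : WithTop ℝ≥0)) ω) ∂μ =
      μ.real (reachAvoidEvent X T t A B) := by
  simp_rw [ind_stoppedValue_entryTime hB hAB hc]
  exact integral_indicator_one
    (measurableSet_reachAvoidEvent hA hB (fun s => (hX s).mono (𝔽.le s) le_rfl) hc)

theorem integral_min_ind_iInf_ind (hA : MeasurableSet A) (hB : IsClosed B) (htT : t ≤ T)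
    (hX : ∀ s, Measurable[𝔽 s] (X s)) (hc : ∀ ω, Continuous fun s => X s ω) :
    ∫ ω, min (ind A (X T ω)) (⨅ q : Set.Icc t T, ind Bᶜ (X q ω)) ∂μ =
      μ.real (reachAvoidEvent X T t A B) := by
  simp_rw [min_ind_iInf_ind htT]
  exact integral_indicator_one
    (measurableSet_reachAvoidEvent hA hB (fun s => (hX s).mono (𝔽.le s) le_rfl) hc)

theorem iInf_integral_min_ind_stoppedValue [IsFiniteMeasure μ] (hA : MeasurableSet A)
    (hB : IsClosed B) (htT : t ≤ T) (hX : ∀ s, Measurable[𝔽 s] (X s))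
    (hc : ∀ ω, Continuous fun s => X s ω) :
    ⨅ τ : stoppingTimes μ 𝔽 t T, ∫ ω, min (ind A (X T ω)) (ind Bᶜ (stoppedValue X τ ω)) ∂μ =
      μ.real (reachAvoidEvent X T t A B) := by
  have : Nonempty (stoppingTimes μ 𝔽 t T) := ⟨⟨_, const_mem_stoppingTimes htT⟩⟩
  have hE : MeasurableSet (reachAvoidEvent X T t A B) :=
    measurableSet_reachAvoidEvent hA hB (fun s => (hX s).mono (𝔽.le s) le_rfl) hc
  apply le_antisymm
  · have hbdd : BddBelow (Set.range fun τ : stoppingTimes μ 𝔽 t T =>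
        ∫ ω, min (ind A (X T ω)) (ind Bᶜ (stoppedValue X τ ω)) ∂μ) :=
      ⟨0, Set.forall_mem_range.2 fun τ => integral_nonneg fun ω =>
        le_min (ind_nonneg _ _) (ind_nonneg _ _)⟩
    refine (ciInf_le hbdd ⟨_, min_entryTime_mem_stoppingTimes hB htT hX hc⟩).trans ?_
    simp_rw [min_ind_stoppedValue_entryTime hB htT hc]
    exact (integral_indicator_one hE).le
  · refine le_ciInf fun τ => ?_
    rw [← integral_indicator_one hE]
    refine integral_mono_ae ((integrable_const (1 : ℝ)).indicator hE)
      (integrable_min_ind_stoppedValue hA hB hX hc τ.2) ?_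
    filter_upwards [τ.2.2] with ω hω
    exact indicator_le_min_ind_stoppedValue hω.1 hω.2

end Reach

/-! ### The controlled state and the suprema over policies -/

section State

variable {Ω : Type*} [mΩ : MeasurableSpace Ω] {n m : ℕ} (S : ControlledSDE n m) (μ : Measure Ω)
  (𝔽 : Filtration ℝ≥0 mΩ) (W : ℝ≥0 → Ω → Euc n) (t : ℝ≥0) (x : Euc n) (u : ℝ≥0 → Ω → Euc m)

/-- Adaptedness holds in both branches of `state`, since the default path is constant; no existence
theorem for the equation is required. -/
theorem measurable_state (s : ℝ≥0) : Measurable[𝔽 s] (state S μ 𝔽 W t x u s) := by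
  unfold state
  split_ifs with h
  · exact h.choose_spec.adapted s
  · exact measurable_const

theorem continuous_state (ω : Ω) : Continuous fun s => state S μ 𝔽 W t x u s ω := by
  unfold state
  split_ifs with h
  · exact h.choose_spec.continuous ω
  · exact continuous_const

variable {T : ℝ≥0} {A B : Set (Euc n)}

theorem value₁_eq (hA : MeasurableSet A) (hB : IsClosed B) (hAB : Disjoint A B) :
    value₁ S μ 𝔽 W T A B t x =
      ⨆ u : S.policies 𝔽, μ.real (reachAvoidEvent (state S μ 𝔽 W t x u) T t A B) :=
  iSup_congr fun u => integral_ind_stoppedValue_entryTime hA hB hAB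
    (measurable_state S μ 𝔽 W t x u) (continuous_state S μ 𝔽 W t x u)

theorem value₂_eq (hA : MeasurableSet A) (hB : IsClosed B) (htT : t ≤ T) :
    value₂ S μ 𝔽 W T A B t x =
      ⨆ u : S.policies 𝔽, μ.real (reachAvoidEvent (state S μ 𝔽 W t x u) T t A B) :=
  iSup_congr fun u => integral_min_ind_iInf_ind hA hB htT
    (measurable_state S μ 𝔽 W t x u) (continuous_state S μ 𝔽 W t x u)

theorem value₃_eq [IsFiniteMeasure μ] (hA : MeasurableSet A) (hB : IsClosed B) (htT : t ≤ T) :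
    value₃ S μ 𝔽 W T A B t x =
      ⨆ u : S.policies 𝔽, μ.real (reachAvoidEvent (state S μ 𝔽 W t x u) T t A B) :=
  iSup_congr fun u => iInf_integral_min_ind_stoppedValue hA hB htT
    (measurable_state S μ 𝔽 W t x u) (continuous_state S μ 𝔽 W t x u)

theorem mem_terminalReachAvoid_iff [IsProbabilityMeasure μ] {p : ℝ} (hp : 0 ≤ p) :
    x ∈ terminalReachAvoid S μ 𝔽 W T A B t p ↔
      p < ⨆ u : S.policies 𝔽, μ.real (reachAvoidEvent (state S μ 𝔽 W t x u) T t A B) := by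
  have hbdd : BddAbove (Set.range fun u : S.policies 𝔽 =>
      μ.real (reachAvoidEvent (state S μ 𝔽 W t x u) T t A B)) :=
    ⟨1, Set.forall_mem_range.2 fun u => measureReal_le_one⟩
  constructor
  · rintro ⟨u, hu, hpu⟩
    exact hpu.trans_le (le_ciSup hbdd ⟨u, hu⟩)
  · intro h
    rcases isEmpty_or_nonempty (S.policies 𝔽) with hemp | hne
    -- With no policies the real supremum is `0` by convention, which cannot exceed `p ≥ 0`.
    · rw [Real.iSup_of_isEmpty] at h
      exact absurd h hp.not_gt
    · obtain ⟨u, hu⟩ := exists_lt_of_lt_ciSup h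
      exact ⟨u, u.2, hu⟩

end State

end ReachAvoid

theorem mainTheorem9 {Ω : Type*} [MeasurableSpace Ω] (μ : Measure Ω) [IsProbabilityMeasure μ]
    [μ.IsComplete] {n m : ℕ} (W : ℝ≥0 → Ω → ReachAvoid.Euc n)
    (hW : ReachAvoid.IsBrownianMotion W μ)
    (S : ReachAvoid.ControlledSDE n m) (hS : S.BasicAssumption)
    (A B : Set (ReachAvoid.Euc n)) (hA : MeasurableSet A) (hB : IsClosed B) (hAB : Disjoint A B)
    (T t r : ℝ≥0) (htT : t ≤ T) (hrt : r ≤ t) :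
    (∀ p ∈ Set.Icc (0 : ℝ) 1,
      ReachAvoid.terminalReachAvoid S μ (ReachAvoid.incrementFiltration hW r) W T A B t p =
        {x | p < ReachAvoid.value₁ S μ (ReachAvoid.incrementFiltration hW r) W T A B t x}) ∧
    ∀ x : ReachAvoid.Euc n,
      ReachAvoid.value₁ S μ (ReachAvoid.incrementFiltration hW r) W T A B t x =
          ReachAvoid.value₂ S μ (ReachAvoid.incrementFiltration hW r) W T A B t x ∧
        ReachAvoid.value₂ S μ (ReachAvoid.incrementFiltration hW r) W T A B t x =
          ReachAvoid.value₃ S μ (ReachAvoid.incrementFiltration hW r) W T A B t x := by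
  refine ⟨fun p hp => Set.ext fun x => ?_, fun x => ⟨?_, ?_⟩⟩
  · rw [ReachAvoid.mem_terminalReachAvoid_iff S μ _ W t x hp.1, Set.mem_ofPred_eq,
      ReachAvoid.value₁_eq S μ _ W t x hA hB hAB]
  · rw [ReachAvoid.value₁_eq S μ _ W t x hA hB hAB,
      ReachAvoid.value₂_eq S μ _ W t x hA hB htT]
  · rw [ReachAvoid.value₂_eq S μ _ W t x hA hB htT,
      ReachAvoid.value₃_eq S μ _ W t x hA hB htT]
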